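/- Let $P:\mathcal C^{op}\to\mathbf{PreOrd}$ be a doctrine (any functor from the opposite of a category $\mathcal C$ to preorders and monotone maps), let $\mathcal C\rtimes P$ be its Grothendieck construction (objects: pairs $(c,x)$ with $x\in P(c)$; arrows $(c,x)\to(d,y)$: arrows $f:c\to d$ of $\mathcal C$ with $x\le P(f)(y)$), and let $J$ be a Grothendieck topology on $\mathcal C\rtimes P$; such a pair $(P,J)$ is a doctrinal site. * The geometric completion $\mathfrak Z(P,J)$ is the doctrine $C_{p_P*}(\Omega_{\mathbf{Sh}(\mathcal C\rtimes P,J)}):\mathcal C^{op}\to\mathbf{PreOrd}$, where $C_{p_P}:\mathbf{Sh}(\mathcal C\rtimes P,J)\to\mathbf{Sets}^{\mathcal C^{op}}$ is the geometric morphism induced by the projection $p_P:\mathcal C\rtimes P\to\mathcal C$ (a comorphism of sites to $\mathcal C$ with the trivial topology), $\Omega$ is the subobject classifier, and the order is the image under $C_{p_P*}$ of the internal order of $\Omega$. * $\mathfrak Z'(P,J)$ is the doctrine whose value at $c$ is the set, ordered by inclusion, of all sets $S$ of pairs $(f,x)$, with $f:d\to c$ an arrow of $\mathcal C$ and $x\in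 P(d)$, such that (a) if $(f,x)\in S$, $g:e\to d$ and $y\le P(g)(x)$ then $(f\circ g,y)\in S$; (b) if $f:d\to c$, $x\in P(d)$, $\{h_i:(e_i,y_i)\to(d,x)\}_{i\in I}$ is a $J$-covering family in $\mathcal C\rtimes P$ and $(f\circ h_i,y_i)\in S$ for all $i$, then $(f,x)\in S$. An arrow $f:d\to c$ acts by $f^*(S)=\{(g,y)\mid (f\circ g,y)\in S\}$. * $P^\top$ is the free top completion: $P^\top(c)$ is $P(c)$ with a new top element $\top_c$ freely added, and $P^\top(f)$ extends $P(f)$ by $\top\mapsto\top$. The topology $J^\top$ on $\mathcal C\rtimes P^\top$ is the one in which a sieve on $(c,x)$ with $x\in P(c)$ is covering iff it is $J$-covering, and a sieve $S$ on $(c,\top_c)$ is covering iff $f^*(S)$ is $J$-covering for every arrow $f:(d,x)\to(c,\top_c)$ with $x\in P(d)$. Then the four doctrines $\mathfrak Z(P,J)$, $\mathfrak Z(P^\top,J^\top)$, $\mathfrak Z'(P^\top,J^\top)$, $\mathfrak Z'(P,J)$ are geometric doctrines (their values are frames; their transition maps are frame homomorphisms that have left adjoints $\exists_f$ satisfying the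 Frobenius condition $\exists_f(u\wedge f^{*}b)=\exists_f u\wedge b$, where $f^{*}$ denotes the transition map of $f$; and they satisfy the relative Beck–Chevalley condition: for a doctrine $\mathbb L$ with these properties, if a sieve $S$ on $(d,V)$ in $\mathcal C\rtimes\mathbb L$ satisfies $V=\bigvee_{(f:(c,U)\to(d,V))\in S}\exists_f U$, then for every arrow $h:e\to d$ the pulled-back sieve $h^*(S)$ on $(e,\mathbb L(h)(V))$ satisfies $\mathbb L(h)(V)=\bigvee_{(g:(c,W)\to(e,\mathbb L(h)(V)))\in h^*(S)}\exists_g W$), and there is a chain of isomorphisms of doctrines over $\mathcal C$ (natural isomorphisms whose components are order isomorphisms) $$\mathfrak Z(P,J)\cong\mathfrak Z(P^\top,J^\top)\cong\mathfrak Z'(P^\top,J^\top)\cong\mathfrak Z'(P,J).$$ In particular $\mathfrak Z(P,J)\cong\mathfrak Z'(P,J)$. -/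

import Mathlib

open CategoryTheory Opposite

universe w v u

namespace Doctrine

variable {C : Type u} [Category.{v} C]

/-- The objects `(c, x)` of the Grothendieck construction `C ⋊ P` of a doctrine
`P : Cᵒᵖ ⥤ Preord`. -/
@[ext]
structure Total (P : Cᵒᵖ ⥤ Preord.{w}) : Type (max u w) where
  base : C
  elt : P.obj (op base)

/-- Arrows `(c, x) ⟶ (d, y)` of `C ⋊ P`: arrows `f : c ⟶ d` of `C` with `x ≤ P(f)(y)`. -/
@[ext]
structure Total.Hom {P : Cᵒᵖ ⥤ Preord.{w}} (X Y : Total P) : Type v where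
  base : X.base ⟶ Y.base
  le : X.elt ≤ P.map base.op Y.elt

instance Total.category (P : Cᵒᵖ ⥤ Preord.{w}) : Category.{v} (Total P) where
  Hom X Y := Total.Hom X Y
  id X := ⟨𝟙 X.base, by simp⟩
  comp {X Y Z} f g := ⟨f.base ≫ g.base, by
    have h : P.map f.base.op Y.elt ≤ P.map f.base.op (P.map g.base.op Z.elt) :=
      (P.map f.base.op).hom.monotone g.le
    simpa using f.le.trans h⟩
  id_comp f := Total.Hom.ext (Category.id_comp f.base)
  comp_id f := Total.Hom.ext (Category.comp_id f.base)
  assoc f g h := Total.Hom.ext (Category.assoc f.base g.base h.base)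

@[simp]
lemma Total.id_base {P : Cᵒᵖ ⥤ Preord.{w}} (X : Total P) :
    Total.Hom.base (𝟙 X) = 𝟙 X.base := rfl

@[simp]
lemma Total.comp_base {P : Cᵒᵖ ⥤ Preord.{w}} {X Y Z : Total P} (f : X ⟶ Y) (g : Y ⟶ Z) :
    Total.Hom.base (f ≫ g) = Total.Hom.base f ≫ Total.Hom.base g := rfl

/-- The arrow `(c, x) ⟶ (d, y)` of `C ⋊ P` given by `f : c ⟶ d` with `x ≤ P(f)(y)`. -/
def Total.homMk {P : Cᵒᵖ ⥤ Preord.{w}} {X Y : Total P} (f : X.base ⟶ Y.base)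
    (h : X.elt ≤ P.map f.op Y.elt) : X ⟶ Y := Total.Hom.mk f h

@[simp]
lemma Total.homMk_base {P : Cᵒᵖ ⥤ Preord.{w}} {X Y : Total P} (f : X.base ⟶ Y.base)
    (h : X.elt ≤ P.map f.op Y.elt) : Total.Hom.base (Total.homMk f h) = f := rfl

/-- The projection `p_P : C ⋊ P ⥤ C`. -/
def Total.proj (P : Cᵒᵖ ⥤ Preord.{w}) : Total P ⥤ C where
  obj X := X.base
  map f := Total.Hom.base f

/-! ### Geometric doctrines -/

section Geometric

variable (L : Cᵒᵖ ⥤ Preord.{w})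

/-- `a` is the value `∃_f u` at `u` of the left adjoint of `L(f) : L(c) → L(d)`. -/
def IsDirectImage {d c : C} (f : d ⟶ c) (u : L.obj (op d)) (a : L.obj (op c)) : Prop :=
  ∀ b : L.obj (op c), a ≤ b ↔ u ≤ L.map f.op b

/-- A sieve `{(c_i, U_i) → (d, V)}` of `C ⋊ L` satisfies `V = ⋁ᵢ ∃_{f_i} U_i`. -/
def IsJoinCover {X : Total L} (S : Sieve X) : Prop :=
  IsLUB {a | ∃ (Y : Total L) (f : Y ⟶ X), S f ∧ IsDirectImage L (Total.Hom.base f) Y.elt a} X.elt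

/-- `L` is a geometric doctrine (an internal locale of the presheaf topos on `C`):
it is a functor to frames and open frame homomorphisms, and it satisfies the relative
Beck-Chevalley condition. -/
structure IsGeometric : Prop where
  /-- each `L(c)` is a partial order -/
  antisymm : ∀ (c : C) (a b : L.obj (op c)), a ≤ b → b ≤ a → a = b
  /-- each `L(c)` is complete -/
  exists_isLUB : ∀ (c : C) (s : Set (L.obj (op c))), ∃ a, IsLUB s a
  /-- binary meets distribute over arbitrary joins -/
  inf_sSup : ∀ (c : C) (a b m : L.obj (op c)) (s : Set (L.obj (op c))), IsLUB s b →
    IsGLB {a, b} m → IsLUB {n | ∃ y ∈ s, IsGLB {a, y} n} m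
  /-- transition maps preserve the top element -/
  map_top : ∀ {d c : C} (f : d ⟶ c) (a : L.obj (op c)), IsTop a → IsTop (L.map f.op a)
  /-- transition maps preserve binary meets -/
  map_inf : ∀ {d c : C} (f : d ⟶ c) (a b m : L.obj (op c)), IsGLB {a, b} m →
    IsGLB {L.map f.op a, L.map f.op b} (L.map f.op m)
  /-- transition maps preserve arbitrary joins -/
  map_sSup : ∀ {d c : C} (f : d ⟶ c) (s : Set (L.obj (op c))) (a : L.obj (op c)), IsLUB s a →
    IsLUB ((fun x => L.map f.op x) '' s) (L.map f.op a)
  /-- transition maps have left adjoints -/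
  exists_directImage : ∀ {d c : C} (f : d ⟶ c) (u : L.obj (op d)), ∃ a, IsDirectImage L f u a
  /-- Frobenius: `∃_f (u ∧ L(f) b) = (∃_f u) ∧ b` -/
  frobenius : ∀ {d c : C} (f : d ⟶ c) (u m : L.obj (op d)) (a b n : L.obj (op c)),
    IsDirectImage L f u a → IsGLB {u, L.map f.op b} m → IsGLB {a, b} n → IsDirectImage L f m n
  /-- relative Beck-Chevalley condition -/
  beckChevalley : ∀ {e d : C} (h : e ⟶ d) (V : L.obj (op d)) (S : Sieve (Total.mk d V)),
    IsJoinCover L S →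
    IsJoinCover L (S.pullback
      (Total.homMk h le_rfl : Total.mk e (L.map h.op V) ⟶ Total.mk d V))

end Geometric

/-! ### The internal order of the subobject classifier of a sheaf topos -/

section OmegaOrder

variable {D : Type u} [Category.{v} D] (J : GrothendieckTopology D)

/-- The presheaf of pairs `S ≤ T` of closed sieves. -/
def omegaLEPresheaf : Dᵒᵖ ⥤ Type (max u v) where
  obj X := {p : Sieve X.unop × Sieve X.unop // J.IsClosed p.1 ∧ J.IsClosed p.2 ∧ p.1 ≤ p.2}
  map f := ↾fun p => ⟨(p.1.1.pullback f.unop, p.1.2.pullback f.unop),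
    J.isClosed_pullback f.unop _ p.2.1, J.isClosed_pullback f.unop _ p.2.2.1,
    Sieve.pullback_monotone _ p.2.2.2⟩
  map_id _ := by
    refine ConcreteCategory.hom_ext _ _ fun _ => Subtype.ext (Prod.ext ?_ ?_)
    · exact Sieve.pullback_id
    · exact Sieve.pullback_id
  map_comp f g := by
    refine ConcreteCategory.hom_ext _ _ fun _ => Subtype.ext (Prod.ext ?_ ?_)
    · exact Sieve.pullback_comp _
    · exact Sieve.pullback_comp _

/-- The first projection to the presheaf of closed sieves. -/
def omegaLEFst : omegaLEPresheaf J ⟶ (Functor.closedSieves J).toFunctor where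
  app X := ↾fun p => ⟨p.1.1, p.2.1⟩
  naturality _ _ _ := rfl

/-- The second projection to the presheaf of closed sieves. -/
def omegaLESnd : omegaLEPresheaf J ⟶ (Functor.closedSieves J).toFunctor where
  app X := ↾fun p => ⟨p.1.2, p.2.2.1⟩
  naturality _ _ _ := rfl

theorem omegaLE_isSheaf : Presieve.IsSheaf J (omegaLEPresheaf J) := by
  intro X S hS x hx
  have hΩ := classifier_isSheaf J S hS
  obtain ⟨a, ha, ha'⟩ := hΩ _ (hx.map (omegaLEFst J))
  obtain ⟨b, hb, hb'⟩ := hΩ _ (hx.map (omegaLESnd J))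
  have hab : (show Sieve X from a.1) ≤ (show Sieve X from b.1) := by
    intro Y g hg
    refine b.2 g (J.superset_covering ?_ (J.pullback_stable g hS))
    intro Z h (hh : S (h ≫ g))
    have e1 : a.1.pullback (h ≫ g) = (x (h ≫ g) hh).1.1 := congrArg Subtype.val (ha (h ≫ g) hh)
    have e2 : b.1.pullback (h ≫ g) = (x (h ≫ g) hh).1.2 := congrArg Subtype.val (hb (h ≫ g) hh)
    have h1 : (show Sieve X from a.1).pullback (h ≫ g) (𝟙 Z) := by
      change (show Sieve X from a.1) (𝟙 Z ≫ h ≫ g)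
      simpa using! (show Sieve X from a.1).downward_closed hg h
    rw [e1] at h1
    have h2 := (x (h ≫ g) hh).2.2.2 _ h1
    rw [← e2] at h2
    change (show Sieve X from b.1) (𝟙 Z ≫ h ≫ g) at h2
    simpa using! h2
  refine ⟨⟨(a.1, b.1), a.2, b.2, hab⟩, ?_, ?_⟩
  · intro Y f hf
    refine Subtype.ext (Prod.ext ?_ ?_)
    · exact congrArg Subtype.val (ha f hf)
    · exact congrArg Subtype.val (hb f hf)
  · intro t ht
    refine Subtype.ext (Prod.ext ?_ ?_)
    · exact congrArg Subtype.val (ha' ⟨t.1.1, t.2.1⟩ fun Y f hf =>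
        congrArg (fun p => (omegaLEFst J).app _ p) (ht f hf))
    · exact congrArg Subtype.val (hb' ⟨t.1.2, t.2.2.1⟩ fun Y f hf =>
        congrArg (fun p => (omegaLESnd J).app _ p) (ht f hf))

/-- The order relation of the subobject classifier of the topos of sheaves. -/
def omegaLE : Sheaf J (Type (max u v)) where
  obj := omegaLEPresheaf J
  property := by
    rw [CategoryTheory.isSheaf_iff_isSheaf_of_type]
    exact omegaLE_isSheaf J

/-- The first projection `(≤) ⟶ Ω`; here `Ω = Sheaf.Ω J`, the sheaf of closed sieves, is the
subobject classifier of `Sh(D, J)`. -/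
def omegaLE.fst : omegaLE J ⟶ Sheaf.Ω J := ⟨omegaLEFst J⟩

/-- The second projection `(≤) ⟶ Ω`. -/
def omegaLE.snd : omegaLE J ⟶ Sheaf.Ω J := ⟨omegaLESnd J⟩

end OmegaOrder

/-! ### The geometric completion -/

section Completion

variable (P : Cᵒᵖ ⥤ Preord.{w}) (J : GrothendieckTopology (Total P))

/-- The projection is a comorphism of sites to `C` with the trivial topology. -/
instance proj_isCocontinuous :
    (Total.proj P).IsCocontinuous J (⊥ : GrothendieckTopology C) where
  cover_lift {U S} hS := by
    rw [GrothendieckTopology.bot_covering] at hS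
    subst hS
    simp

/-- The direct image functor `C_{p_P *} : Sh(C ⋊ P, J) ⥤ (Cᵒᵖ ⥤ Type)` of the geometric morphism
induced by the comorphism `p_P`: right Kan extension along `p_P`, the right adjoint of the inverse
image `F ↦ a_J(F ∘ p_P)`. -/
noncomputable def directImage :
    Sheaf J (Type (max u v w)) ⥤ (Cᵒᵖ ⥤ Type (max u v w)) :=
  (Total.proj P).sheafPushforwardCocontinuous (Type (max u v w)) J ⊥ ⋙ sheafToPresheaf _ _

variable {P J} in
/-- The component at `X = (c, x)` of the counit `C_{p_P *}(F) ∘ p_P ⟶ F`. -/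
noncomputable def directImageEval (F : Sheaf J (Type (max u v w))) (X : Total P)
    (z : ((directImage P J).obj F).obj (op X.base)) : F.obj.obj (op X) :=
  (((Total.proj P).op.ranCounit.app F.obj).app (op X)) z

variable {P J} in
theorem directImageEval_naturality {F G : Sheaf J (Type (max u v w))} (φ : F ⟶ G) (X : Total P)
    (z : ((directImage P J).obj F).obj (op X.base)) :
    directImageEval G X (((directImage P J).map φ).app _ z) =
      φ.hom.app _ (directImageEval F X z) := by
  have h := congr_app ((Total.proj P).op.ranCounit.naturality φ.hom) (op X)
  exact ConcreteCategory.congr_hom h z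

variable {P J} in
theorem directImageEval_map (F : Sheaf J (Type (max u v w))) {X Y : Total P} (g : Y ⟶ X)
    (z : ((directImage P J).obj F).obj (op X.base)) :
    directImageEval F Y (((directImage P J).obj F).map (Total.Hom.base g).op z) =
      F.obj.map g.op (directImageEval F X z) :=
  ConcreteCategory.congr_hom (((Total.proj P).op.ranCounit.app F.obj).naturality g.op) z

variable {P J} in
theorem directImage_ext (F : Sheaf J (Type (max u v w))) (c : C)
    (z z' : ((directImage P J).obj F).obj (op c))
    (h : ∀ (X : Total P) (f : X.base ⟶ c),
      directImageEval F X (((directImage P J).obj F).map f.op z) =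
        directImageEval F X (((directImage P J).obj F).map f.op z')) : z = z' := by
  have hlim := (Total.proj P).op.isPointwiseRightKanExtensionRanCounit F.obj (op c)
  refine (Limits.Types.isLimitEquivSections hlim).injective (Subtype.ext (funext fun j => ?_))
  exact h j.right.unop j.hom.unop

variable {P J} in
theorem directImage_exists (F : Sheaf J (Type (max u v w))) (c : C)
    (s : ∀ (X : Total P) (_ : X.base ⟶ c), F.obj.obj (op X))
    (hs : ∀ (X Y : Total P) (g : Y ⟶ X) (f : X.base ⟶ c),
      F.obj.map g.op (s X f) = s Y (Total.Hom.base g ≫ f)) :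
    ∃ z : ((directImage P J).obj F).obj (op c), ∀ (X : Total P) (f : X.base ⟶ c),
      directImageEval F X (((directImage P J).obj F).map f.op z) = s X f := by
  have hlim := (Total.proj P).op.isPointwiseRightKanExtensionRanCounit F.obj (op c)
  let t : (StructuredArrow.proj (op c) (Total.proj P).op ⋙ F.obj).sections :=
    ⟨fun j => s j.right.unop j.hom.unop, by
      intro j j' g
      refine (hs j.right.unop j'.right.unop g.right.unop j.hom.unop).trans ?_
      have hw : j.hom ≫ (Total.proj P).op.map g.right = j'.hom := StructuredArrow.w g
      exact congrArg (s j'.right.unop) (congrArg Quiver.Hom.unop hw)⟩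
  refine ⟨(Limits.Types.isLimitEquivSections hlim).symm t, fun X f => ?_⟩
  exact congrFun (congrArg Subtype.val
    ((Limits.Types.isLimitEquivSections hlim).apply_symm_apply t))
      (StructuredArrow.mk (Y := op X) (T := (Total.proj P).op) f.op)

/-- The elements of `C_{p_P *}(Ω)(c)`, where `Ω` is the subobject classifier of
`Sh(C ⋊ P, J)`. -/
def CompletionFibre (c : C) : Type (max u v w) :=
  ((directImage P J).obj (Sheaf.Ω J)).obj (op c)

/-- The order of the internal frame `C_{p_P *}(Ω)`: the image under `C_{p_P *}` of the order
relation `(≤) ⟶ Ω × Ω` of the subobject classifier. -/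
noncomputable instance (c : C) : LE (CompletionFibre P J c) where
  le x y := ∃ z : ((directImage P J).obj (omegaLE J)).obj (op c),
    ((directImage P J).map (omegaLE.fst J)).app (op c) z = x ∧
    ((directImage P J).map (omegaLE.snd J)).app (op c) z = y

variable {P J} in
/-- The component of `x ∈ C_{p_P *}(Ω)(c)` at `X` and `f`, a (closed) sieve on `X`. -/
noncomputable def CompletionFibre.sieve {c : C} (x : CompletionFibre P J c) (X : Total P)
    (f : X.base ⟶ c) : Sieve X :=
  (directImageEval (Sheaf.Ω J) X (((directImage P J).obj (Sheaf.Ω J)).map f.op x)).1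

variable {P J} in
theorem CompletionFibre.isClosed_sieve {c : C} (x : CompletionFibre P J c) (X : Total P)
    (f : X.base ⟶ c) : J.IsClosed (x.sieve X f) :=
  (directImageEval (Sheaf.Ω J) X (((directImage P J).obj (Sheaf.Ω J)).map f.op x)).2

variable {P J} in
theorem CompletionFibre.pullback_sieve {c : C} (x : CompletionFibre P J c) {X Y : Total P}
    (g : Y ⟶ X) (f : X.base ⟶ c) :
    (x.sieve X f).pullback g = x.sieve Y (Total.Hom.base g ≫ f) := by
  have h := directImageEval_map (Sheaf.Ω J) g (((directImage P J).obj (Sheaf.Ω J)).map f.op x)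
  have h2 : ((directImage P J).obj (Sheaf.Ω J)).map (Total.Hom.base g ≫ f).op x =
      ((directImage P J).obj (Sheaf.Ω J)).map (Total.Hom.base g).op
        (((directImage P J).obj (Sheaf.Ω J)).map f.op x) := by
    rw [op_comp]
    exact ConcreteCategory.congr_hom (((directImage P J).obj (Sheaf.Ω J)).map_comp _ _) x
  unfold CompletionFibre.sieve
  rw [h2, h]
  rfl

variable {P J} in
theorem CompletionFibre.le_iff {c : C} (x y : CompletionFibre P J c) :
    x ≤ y ↔ ∀ (X : Total P) (f : X.base ⟶ c),
      x.sieve X f ≤ y.sieve X f := by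
  have nat : ∀ (φ : omegaLE J ⟶ Sheaf.Ω J) (z : ((directImage P J).obj (omegaLE J)).obj (op c))
      (X : Total P) (f : X.base ⟶ c),
      directImageEval (Sheaf.Ω J) X (((directImage P J).obj (Sheaf.Ω J)).map f.op
        (((directImage P J).map φ).app (op c) z)) =
      φ.hom.app _ (directImageEval (omegaLE J) X
        (((directImage P J).obj (omegaLE J)).map f.op z)) := by
    intro φ z X f
    rw [← directImageEval_naturality]
    exact congrArg (directImageEval (Sheaf.Ω J) X)
      (ConcreteCategory.congr_hom (((directImage P J).map φ).naturality f.op) z).symm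
  constructor
  · rintro ⟨z, rfl, rfl⟩ X f
    unfold CompletionFibre.sieve
    rw [nat, nat]
    exact (directImageEval (omegaLE J) X
      (((directImage P J).obj (omegaLE J)).map f.op z)).2.2.2
  · intro h
    obtain ⟨z, hz⟩ := directImage_exists (omegaLE J) c
      (fun X f => ⟨(x.sieve X f, y.sieve X f), x.isClosed_sieve X f, y.isClosed_sieve X f, h X f⟩)
      (fun X Y g f => Subtype.ext (Prod.ext (x.pullback_sieve g f) (y.pullback_sieve g f)))
    refine ⟨z, directImage_ext _ _ _ _ fun X f => ?_, directImage_ext _ _ _ _ fun X f => ?_⟩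
    · rw [nat, hz]; rfl
    · rw [nat, hz]; rfl

noncomputable instance (c : C) : Preorder (CompletionFibre P J c) where
  toLE := inferInstance
  le_refl x := (CompletionFibre.le_iff x x).2 fun _ _ => le_rfl
  le_trans x y z h₁ h₂ := (CompletionFibre.le_iff x z).2 fun X f =>
    ((CompletionFibre.le_iff x y).1 h₁ X f).trans ((CompletionFibre.le_iff y z).1 h₂ X f)

/-- The geometric completion of `(P, J)`: the doctrine `C_{p_P *}(Ω) : Cᵒᵖ ⥤ Preord`. -/
noncomputable def geometricCompletion : Cᵒᵖ ⥤ Preord.{max u v w} where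
  obj c := Preord.of (CompletionFibre P J c.unop)
  map {c d} f := Preord.ofHom
    { toFun := fun x => ((directImage P J).obj (Sheaf.Ω J)).map f x
      monotone' := by
        rintro _ _ ⟨z, rfl, rfl⟩
        exact ⟨((directImage P J).obj (omegaLE J)).map f z,
          ConcreteCategory.congr_hom
            (((directImage P J).map (omegaLE.fst J)).naturality f) z,
          ConcreteCategory.congr_hom
            (((directImage P J).map (omegaLE.snd J)).naturality f) z⟩ }
  map_id c := Preord.ext fun x =>
    ConcreteCategory.congr_hom (((directImage P J).obj (Sheaf.Ω J)).map_id c) x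
  map_comp f g := Preord.ext fun x =>
    ConcreteCategory.congr_hom (((directImage P J).obj (Sheaf.Ω J)).map_comp f g) x

/-! ### The concrete description -/

/-- The `J`-closed sets of pairs `(f, x)`, with `f : d ⟶ c` an arrow of `C` and `x ∈ P(d)`. -/
@[ext]
structure ClosedPairs (c : C) : Type (max u v w) where
  pairs : Set (Σ d : C, (d ⟶ c) × P.obj (op d))
  down_closed : ∀ {d e : C} (f : d ⟶ c) (x : P.obj (op d)) (g : e ⟶ d) (y : P.obj (op e)),
    ⟨d, f, x⟩ ∈ pairs → y ≤ P.map g.op x → ⟨e, g ≫ f, y⟩ ∈ pairs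
  /-- If a family `{(e_i, y_i) → (d, x)}` of arrows `h_i` of `C ⋊ P` is `J`-covering (generates a
  `J`-covering sieve) and each `(f ∘ h_i, y_i)` is in the set, then so is `(f, x)`. -/
  cover_closed : ∀ {d : C} (f : d ⟶ c) (x : P.obj (op d)) (R : Presieve (Total.mk d x)),
    Sieve.generate R ∈ J (Total.mk d x) →
    (∀ (Y : Total P) (h : Y ⟶ Total.mk d x), R h →
      ⟨Y.base, Total.Hom.base h ≫ f, Y.elt⟩ ∈ pairs) →
    ⟨d, f, x⟩ ∈ pairs

/-- Inclusion order. -/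
instance (c : C) : PartialOrder (ClosedPairs P J c) :=
  PartialOrder.lift ClosedPairs.pairs fun _ _ => ClosedPairs.ext

variable {P J} in
/-- `f^*(S) = {(g, y) | (f ∘ g, y) ∈ S}`. -/
def ClosedPairs.pullback {d c : C} (f : d ⟶ c) (S : ClosedPairs P J c) : ClosedPairs P J d where
  pairs := {p | (⟨p.1, p.2.1 ≫ f, p.2.2⟩ : Σ e : C, (e ⟶ c) × P.obj (op e)) ∈ S.pairs}
  down_closed k x g y hx hy := by
    simpa using S.down_closed (k ≫ f) x g y hx hy
  cover_closed k x R hR h := S.cover_closed (k ≫ f) x R hR fun Y g hg => by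
    simpa using h Y g hg

/-- The doctrine of `J`-closed sets of pairs. -/
def closedPairsDoctrine : Cᵒᵖ ⥤ Preord.{max u v w} where
  obj c := Preord.of (ClosedPairs P J c.unop)
  map f := Preord.ofHom
    { toFun := ClosedPairs.pullback f.unop
      monotone' := fun _ _ h _ hp => h hp }
  map_id c := Preord.ext fun S => ClosedPairs.ext (by
    ext ⟨d, k, x⟩
    change (⟨d, k ≫ 𝟙 _, x⟩ : Σ e : C, _) ∈ S.pairs ↔ _
    simp)
  map_comp f g := Preord.ext fun S => ClosedPairs.ext (by
    ext ⟨d, k, x⟩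
    change (⟨d, k ≫ g.unop ≫ f.unop, x⟩ : Σ e : C, _) ∈ S.pairs ↔
      (⟨d, (k ≫ g.unop) ≫ f.unop, x⟩ : Σ e : C, _) ∈ S.pairs
    simp)

/-! ### The free top completion -/

/-- The free top completion `P^⊤`. -/
def freeTop : Cᵒᵖ ⥤ Preord.{w} where
  obj c := Preord.of (WithTop (P.obj c))
  map f := Preord.ofHom
    { toFun := WithTop.map (P.map f)
      monotone' := (P.map f).hom.monotone.withTop_map }
  map_id c := Preord.ext fun x => by
    induction x using WithTop.recTopCoe <;> simp
  map_comp f g := Preord.ext fun x => by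
    induction x using WithTop.recTopCoe <;> simp

/-- The inclusion `C ⋊ P ⥤ C ⋊ P^⊤`. -/
def freeTopIncl : Total P ⥤ Total (freeTop P) where
  obj X := ⟨X.base, ((X.elt : P.obj (op X.base)) : WithTop (P.obj (op X.base)))⟩
  map {X Y} f := Total.homMk (Total.Hom.base (X := X) (Y := Y) f)
    (WithTop.coe_le_coe.2 (Total.Hom.le (X := X) (Y := Y) f))
  map_id _ := rfl
  map_comp _ _ := rfl

instance : (freeTopIncl P).Full where
  map_surjective {X Y} f :=
    ⟨Total.homMk (Total.Hom.base (X := (freeTopIncl P).obj X) (Y := (freeTopIncl P).obj Y) f :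
        X.base ⟶ Y.base)
      (WithTop.coe_le_coe.1
        (Total.Hom.le (X := (freeTopIncl P).obj X) (Y := (freeTopIncl P).obj Y) f)), rfl⟩

variable {P} in
/-- The topology `J^⊤` on `C ⋊ P^⊤`, described by one condition for all objects; the two lemmas
below unfold it on the objects `(c, x)` with `x ∈ P(c)` and on the objects `(c, ⊤)`. -/
def freeTopTopology : GrothendieckTopology (Total (freeTop P)) where
  sieves X := {S | ∀ (Y : Total P) (f : (freeTopIncl P).obj Y ⟶ X),
    (S.pullback f).functorPullback (freeTopIncl P) ∈ J Y}
  top_mem' X Y f := by simp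
  pullback_stable' X Z S g hS Y f := by
    simpa [Sieve.pullback_comp] using hS Y (f ≫ g)
  transitive' X S hS R h Y f := by
    refine J.transitive (hS Y f) _ fun Z g hg => ?_
    have := h hg Z (𝟙 _)
    simpa [Sieve.pullback_comp, Sieve.functorPullback_pullback] using this

/-- On an object `(c, x)` with `x ∈ P(c)`, a sieve is `J^⊤`-covering iff it is `J`-covering. -/
theorem mem_freeTopTopology_incl (Y : Total P) (S : Sieve ((freeTopIncl P).obj Y)) :
    S ∈ freeTopTopology J _ ↔ S.functorPullback (freeTopIncl P) ∈ J Y := by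
  constructor
  · intro h
    simpa using h Y (𝟙 _)
  · intro h Z f
    obtain ⟨g, rfl⟩ := (freeTopIncl P).map_surjective f
    simpa [Sieve.functorPullback_pullback] using J.pullback_stable g h

/-- On an object `(c, ⊤)`, a sieve `S` is `J^⊤`-covering iff `f^* S` is `J`-covering for each
arrow `f : (d, x) ⟶ (c, ⊤)` with `x ∈ P(d)`. -/
theorem mem_freeTopTopology_top (c : C)
    (S : Sieve (Total.mk c (⊤ : WithTop (P.obj (op c))) : Total (freeTop P))) :
    S ∈ freeTopTopology J _ ↔ ∀ (Y : Total P) (f : (freeTopIncl P).obj Y ⟶ _),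
      (S.pullback f).functorPullback (freeTopIncl P) ∈ J Y :=
  Iff.rfl

end Completion

end Doctrine

/-! Everything is compared with closed sets of pairs. Since C_{p_P*} is a right Kan extension
computed pointwise, an element of the completion over c is a family of J-closed sieves, one for each
object X of C ⋊ P and arrow f : X.base ⟶ c, compatible with pullback. Compatibility means that the
family is determined by the pairs (f, x) at which its sieve is maximal, and these pairs form an
arbitrary closed set; on both sides the order is inclusion. This is `completionIso`, used for (P, J)
and for (P^⊤, J^⊤).

For the free top completion, the arrows into a fixed object of C ⋊ P^⊤ that factor through C ⋊ P
form a J^⊤-covering sieve. A closed set for P^⊤ is therefore recovered from its pairs with second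
entry in P, which gives `restrictIso`.

Geometricity is invariant under isomorphism, so it only has to be checked on closed sets of pairs.
There intersection has a right adjoint `imp`, and pullback has adjoints `existsAlong` and
`forallAlong` on both sides. Distributivity, Frobenius and preservation of joins follow from these
adjunctions; Beck–Chevalley uses `forallAlong` and a test on principal closed sets. -/

namespace Doctrine

variable {C : Type u} [Category.{v} C]

/-! ### Transport of geometricity along isomorphisms of doctrines -/

section OrderIso

variable {L L' : Cᵒᵖ ⥤ Preord.{w}}

/-- A natural family of order isomorphisms is an isomorphism of doctrines. -/
def isoOfOrderIso (E : ∀ c : C, L.obj (op c) ≃o L'.obj (op c))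
    (hE : ∀ {d c : C} (f : d ⟶ c) (x : L.obj (op c)),
      E d (L.map f.op x) = L'.map f.op (E c x)) : L ≅ L' :=
  NatIso.ofComponents (fun c => Preord.Iso.mk (E c.unop))
    (fun f => Preord.ext fun x => hE f.unop x)

theorem IsDirectImage.of_orderIso (E : ∀ c : C, L.obj (op c) ≃o L'.obj (op c))
    (hE : ∀ {d c : C} (f : d ⟶ c) (x : L.obj (op c)),
      E d (L.map f.op x) = L'.map f.op (E c x))
    {d c : C} {f : d ⟶ c} {u : L.obj (op d)} {a : L.obj (op c)} :
    IsDirectImage L' f (E d u) (E c a) ↔ IsDirectImage L f u a := by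
  unfold IsDirectImage
  rw [(E c).surjective.forall]
  simp [← hE]

/-- Since ∃_f U ≤ b iff U ≤ L(f)(b), upper bounds of the direct images can be described without
mentioning direct images. Join covers are handled in this form from here on. -/
theorem isJoinCover_iff
    (h : ∀ {d c : C} (f : d ⟶ c) (u : L.obj (op d)), ∃ a, IsDirectImage L f u a)
    {X : Total L} (S : Sieve X) :
    IsJoinCover L S ↔ ∀ b : L.obj (op X.base), X.elt ≤ b ↔
      ∀ (Y : Total L) (f : Y ⟶ X), S f → Y.elt ≤ L.map (Total.Hom.base f).op b := by
  unfold IsJoinCover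
  rw [isLUB_iff_le_iff]
  refine forall_congr' fun b => iff_congr Iff.rfl ?_
  constructor
  · intro hb Y f hf
    obtain ⟨a, ha⟩ := h (Total.Hom.base f) Y.elt
    exact (ha b).1 (hb ⟨Y, f, hf, ha⟩)
  · rintro hb a ⟨Y, f, hf, ha⟩
    exact (ha b).2 (hb Y f hf)

theorem isGLB_pair_orderIso {A B : Type*} [Preorder A] [Preorder B] (E : A ≃o B) {a b m : A} :
    IsGLB {E a, E b} (E m) ↔ IsGLB {a, b} m := by
  rw [← Set.image_pair, E.isGLB_image']

/-- Geometric doctrines are closed under isomorphism. -/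
theorem IsGeometric.of_orderIso (hL : IsGeometric L)
    (E : ∀ c : C, L.obj (op c) ≃o L'.obj (op c))
    (hE : ∀ {d c : C} (f : d ⟶ c) (x : L.obj (op c)),
      E d (L.map f.op x) = L'.map f.op (E c x)) : IsGeometric L' := by
  have hdir : ∀ {d c : C} (f : d ⟶ c) (u : L'.obj (op d)), ∃ a, IsDirectImage L' f u a := by
    intro d c f u
    obtain ⟨u, rfl⟩ := (E d).surjective u
    obtain ⟨a, ha⟩ := hL.exists_directImage f u
    exact ⟨E c a, (IsDirectImage.of_orderIso E hE).2 ha⟩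
  refine ⟨?_, ?_, ?_, ?_, ?_, ?_, hdir, ?_, ?_⟩
  · intro c a b h₁ h₂
    exact (E c).symm.injective (hL.antisymm c _ _ ((E c).symm.monotone h₁)
      ((E c).symm.monotone h₂))
  · intro c s
    obtain ⟨a, ha⟩ := hL.exists_isLUB c ((E c).symm '' s)
    exact ⟨E c a, by simpa using (E c).isLUB_image'.2 ha⟩
  · intro c a b m s hs hm
    obtain ⟨a, rfl⟩ := (E c).surjective a
    obtain ⟨b, rfl⟩ := (E c).surjective b
    obtain ⟨m, rfl⟩ := (E c).surjective m
    obtain ⟨s, rfl⟩ := (E c).surjective.image_surjective s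
    have h := hL.inf_sSup c a b m s ((E c).isLUB_image'.1 hs) ((isGLB_pair_orderIso (E c)).1 hm)
    convert (E c).isLUB_image'.2 h
    ext n
    obtain ⟨n, rfl⟩ := (E c).surjective n
    simp [isGLB_pair_orderIso]
  · intro d c f a ha
    obtain ⟨a, rfl⟩ := (E c).surjective a
    rw [← hE]
    have := hL.map_top f a fun x => (E c).le_iff_le.1 (ha _)
    intro x
    obtain ⟨x, rfl⟩ := (E d).surjective x
    exact (E d).monotone (this x)
  · intro d c f a b m hm
    obtain ⟨a, rfl⟩ := (E c).surjective a
    obtain ⟨b, rfl⟩ := (E c).surjective b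
    obtain ⟨m, rfl⟩ := (E c).surjective m
    rw [← hE, ← hE, ← hE, isGLB_pair_orderIso]
    exact hL.map_inf f a b m ((isGLB_pair_orderIso (E c)).1 hm)
  · intro d c f s a ha
    obtain ⟨a, rfl⟩ := (E c).surjective a
    obtain ⟨s, rfl⟩ := (E c).surjective.image_surjective s
    have h := (E d).isLUB_image'.2 (hL.map_sSup f s a ((E c).isLUB_image'.1 ha))
    simpa only [Set.image_image, hE] using h
  · intro d c f u m a b n ha hm hn
    obtain ⟨u, rfl⟩ := (E d).surjective u
    obtain ⟨m, rfl⟩ := (E d).surjective m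
    obtain ⟨a, rfl⟩ := (E c).surjective a
    obtain ⟨b, rfl⟩ := (E c).surjective b
    obtain ⟨n, rfl⟩ := (E c).surjective n
    rw [← hE, isGLB_pair_orderIso] at hm
    rw [isGLB_pair_orderIso] at hn
    rw [IsDirectImage.of_orderIso E hE] at ha ⊢
    exact hL.frobenius f u m a b n ha hm hn
  · intro e d h V S hS
    obtain ⟨V, rfl⟩ := (E d).surjective V
    rw [isJoinCover_iff hdir] at hS ⊢
    -- The isomorphism acts on the total categories; it carries S back to a sieve for L, where
    -- Beck–Chevalley is known.
    let F : Total L ⥤ Total L' :=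
      { obj := fun X => ⟨X.base, E X.base X.elt⟩
        map := fun {X Y} f => Total.homMk (Total.Hom.base (X := X) (Y := Y) f) (by
          rw [← hE]
          exact (E X.base).monotone (Total.Hom.le (X := X) (Y := Y) f)) }
    have hS' : IsJoinCover L (X := ⟨d, V⟩) (S.functorPullback F) := by
      rw [isJoinCover_iff hL.exists_directImage]
      intro b
      refine ((E d).le_iff_le.symm.trans (hS (E d b))).trans ?_
      constructor
      · intro H Y f hf
        have := H (F.obj Y) (F.map f) hf
        exact (E _).le_iff_le.1 (this.trans_eq (hE _ _).symm)
      · rintro H ⟨y, U⟩ f hf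
        obtain ⟨U, rfl⟩ := (E y).surjective U
        let k : y ⟶ d := Total.Hom.base f
        have hle : U ≤ L.map k.op V := by
          refine (E y).le_iff_le.1 ((Total.Hom.le f).trans_eq ?_)
          exact (hE _ _).symm
        have := H ⟨y, U⟩ (Total.homMk k hle) hf
        exact ((E y).monotone this).trans_eq (hE _ _)
    have h2 := (isJoinCover_iff hL.exists_directImage _).1 (hL.beckChevalley h V _ hS')
    intro b
    obtain ⟨b, rfl⟩ := (E e).surjective b
    -- The forward implication is monotonicity and holds for any sieve; only the converse needs the
    -- join cover.
    constructor
    · rintro H Y f -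
      exact (Total.Hom.le f).trans ((L'.map (Total.Hom.base f).op).hom.monotone H)
    · intro H
      change L'.map h.op (E d V) ≤ _
      rw [← hE]
      refine (E e).monotone ((h2 b).2 fun Y f hf => ?_)
      let k : Y.base ⟶ e := Total.Hom.base f
      have hle : E Y.base Y.elt ≤ L'.map k.op (L'.map h.op (E d V)) := by
        rw [← hE, ← hE]
        exact (E _).monotone (Total.Hom.le f)
      have := H ⟨Y.base, E _ Y.elt⟩ (Total.homMk k hle) hf
      exact (E _).le_iff_le.1 (this.trans_eq (hE _ _).symm)

end OrderIso

variable {P : Cᵒᵖ ⥤ Preord.{w}} {J : GrothendieckTopology (Total P)}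

/-! ### Lattice operations and adjoints on closed sets of pairs -/

namespace ClosedPairs

/-- The pair `(f, x)` belongs to `S`. -/
def Mem {c : C} (S : ClosedPairs P J c) {d : C} (f : d ⟶ c) (x : P.obj (op d)) : Prop :=
  ⟨d, f, x⟩ ∈ S.pairs

theorem le_def {c : C} {S T : ClosedPairs P J c} :
    S ≤ T ↔ ∀ {d : C} (f : d ⟶ c) (x : P.obj (op d)), S.Mem f x → T.Mem f x :=
  ⟨fun h _ _ _ hx => h hx, fun h p hp => h p.2.1 p.2.2 hp⟩

theorem Mem.comp {c d e : C} {S : ClosedPairs P J c} {f : d ⟶ c} {x : P.obj (op d)}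
    (h : S.Mem f x) (g : e ⟶ d) {y : P.obj (op e)} (hy : y ≤ P.map g.op x) : S.Mem (g ≫ f) y :=
  S.down_closed f x g y h hy

theorem mem_id_comp {c d : C} (S : ClosedPairs P J c) {f : d ⟶ c} {x : P.obj (op d)} :
    S.Mem (𝟙 d ≫ f) x ↔ S.Mem f x := by
  rw [Category.id_comp]

theorem mem_of_cover {c d : C} (S : ClosedPairs P J c) {f : d ⟶ c} {x : P.obj (op d)}
    {R : Sieve (Total.mk d x)} (hR : R ∈ J _)
    (h : ∀ (Y : Total P) (g : Y ⟶ Total.mk d x), R g → S.Mem (Total.Hom.base g ≫ f) Y.elt) :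
    S.Mem f x :=
  S.cover_closed f x R.arrows (by simpa using hR) h

/-- A closed set of pairs from a predicate that is closed under covering sieves. -/
def ofPred {c : C} (p : ∀ {d : C}, (d ⟶ c) → P.obj (op d) → Prop)
    (hd : ∀ {d e : C} (f : d ⟶ c) (x : P.obj (op d)) (g : e ⟶ d) (y : P.obj (op e)),
      p f x → y ≤ P.map g.op x → p (g ≫ f) y)
    (hc : ∀ {d : C} (f : d ⟶ c) (x : P.obj (op d)) (R : Sieve (Total.mk d x)), R ∈ J _ →
      (∀ (Y : Total P) (g : Y ⟶ Total.mk d x), R g → p (Total.Hom.base g ≫ f) Y.elt) → p f x) :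
    ClosedPairs P J c where
  pairs := {q | p q.2.1 q.2.2}
  down_closed := hd
  cover_closed f x R hR h := by
    -- An arrow of the generated sieve factors through a member of R, so downward closure extends
    -- the hypothesis from the family to the sieve.
    refine hc f x _ hR ?_
    rintro Y _ ⟨Z, g, k, hk, rfl⟩
    simpa using hd _ _ (Total.Hom.base g) Y.elt (h Z k hk) (Total.Hom.le g)

theorem mem_pullback {d c e : C} {f : d ⟶ c} {S : ClosedPairs P J c} {g : e ⟶ d}
    {x : P.obj (op e)} : (S.pullback f).Mem g x ↔ S.Mem (g ≫ f) x := Iff.rfl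

/-- The least closed set of pairs containing a given set. -/
def closure {c : C} (A : Set (Σ d : C, (d ⟶ c) × P.obj (op d))) : ClosedPairs P J c :=
  ofPred (fun f x => ∀ S : ClosedPairs P J c, A ⊆ S.pairs → S.Mem f x)
    (fun _ _ g _ h hy S hS => (h S hS).comp g hy)
    (fun _ _ _ hR h S hS => S.mem_of_cover hR fun Y g hg => h Y g hg S hS)

theorem closure_le {c : C} {A : Set (Σ d : C, (d ⟶ c) × P.obj (op d))} {S : ClosedPairs P J c} :
    closure A ≤ S ↔ A ⊆ S.pairs :=
  ⟨fun h p hp => h (show p ∈ (closure A).pairs from fun _ hT => hT hp),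
    fun h _ hp => hp S h⟩

/-- The set of all pairs. -/
def univ (c : C) : ClosedPairs P J c :=
  ofPred (fun _ _ => True) (fun _ _ _ _ _ _ => trivial) (fun _ _ _ _ _ => trivial)

/-- The intersection of two closed sets of pairs. -/
def inter {c : C} (S T : ClosedPairs P J c) : ClosedPairs P J c :=
  ofPred (fun f x => S.Mem f x ∧ T.Mem f x)
    (fun _ _ g _ h hy => ⟨h.1.comp g hy, h.2.comp g hy⟩)
    (fun _ _ _ hR h => ⟨S.mem_of_cover hR fun Y g hg => (h Y g hg).1,
      T.mem_of_cover hR fun Y g hg => (h Y g hg).2⟩)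

/-- The geometric axioms speak of arbitrary greatest lower bounds; by uniqueness each one is the
intersection, so membership can be tested pair by pair. -/
theorem mem_of_isGLB {c d : C} {S T M : ClosedPairs P J c} (h : IsGLB {S, T} M)
    {f : d ⟶ c} {x : P.obj (op d)} : M.Mem f x ↔ S.Mem f x ∧ T.Mem f x := by
  have e : M = inter S T := h.unique ⟨by
    rintro _ (rfl | rfl)
    · exact fun _ hp => hp.1
    · exact fun _ hp => hp.2, fun U hU p hp => ⟨hU (by simp) hp, hU (by simp) hp⟩⟩
  rw [e]
  rfl

theorem isGLB_of_mem {c : C} {S T M : ClosedPairs P J c}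
    (h : ∀ {d : C} (f : d ⟶ c) (x : P.obj (op d)), M.Mem f x ↔ S.Mem f x ∧ T.Mem f x) :
    IsGLB {S, T} M := by
  refine ⟨?_, fun U hU p hp => (h p.2.1 p.2.2).2 ⟨hU (by simp) hp, hU (by simp) hp⟩⟩
  rintro _ (rfl | rfl)
  · exact fun p hp => ((h p.2.1 p.2.2).1 hp).1
  · exact fun p hp => ((h p.2.1 p.2.2).1 hp).2

/-- The Heyting implication of closed sets of pairs. -/
def imp {c : C} (S T : ClosedPairs P J c) : ClosedPairs P J c :=
  ofPred (fun {d} f x => ∀ (e : C) (g : e ⟶ d) (y : P.obj (op e)), y ≤ P.map g.op x →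
      S.Mem (g ≫ f) y → T.Mem (g ≫ f) y)
    (fun {d e} f x g y h hy a k z hz hS => by
      have := h a (k ≫ g) z (by
        simpa using hz.trans ((P.map k.op).hom.monotone hy))
      simp only [Category.assoc] at this
      exact this hS)
    (fun {d} f x R hR h e g y hy hS => by
      refine T.mem_of_cover (J.pullback_stable
        (Total.homMk g hy : Total.mk e y ⟶ Total.mk d x) hR) fun Y k hk => ?_
      have := h Y _ hk Y.base (𝟙 _) Y.elt (by simp)
      simp only [Category.id_comp, Total.comp_base, Total.homMk_base, Category.assoc] at this
      exact this (hS.comp _ (Total.Hom.le k)))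

/-- The Heyting adjunction, source of both frame distributivity and Frobenius. Quantifying over
restrictions in `imp` makes it downward closed; the identity restriction gives back modus ponens. -/
theorem le_imp_iff {c : C} {S T U M : ClosedPairs P J c} (h : IsGLB {S, U} M) :
    U ≤ imp S T ↔ M ≤ T := by
  constructor
  · intro hU
    rw [le_def] at hU ⊢
    intro d f x hx
    rw [mem_of_isGLB h] at hx
    simpa using hU f x hx.2 d (𝟙 d) x (by simp) (by simpa using hx.1)
  · intro hM
    rw [le_def] at hM ⊢
    exact fun {d} f x hx e g y hy hS => hM _ _ ((mem_of_isGLB h).2 ⟨hS, hx.comp g hy⟩)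

/-- The right adjoint of the pullback of closed sets of pairs. -/
def forallAlong {d c : C} (f : d ⟶ c) (T : ClosedPairs P J d) : ClosedPairs P J c :=
  -- C need not have pullbacks, so all commutative squares over f and k are used in place of one
  -- chosen pullback square.
  ofPred (fun {b} k x => ∀ (a : C) (g : a ⟶ b) (y : P.obj (op a)) (l : a ⟶ d),
      y ≤ P.map g.op x → l ≫ f = g ≫ k → T.Mem l y)
    (fun {b b'} k x g y h hy a g' y' l hy' hl =>
      h a (g' ≫ g) y' l (by simpa using hy'.trans ((P.map g'.op).hom.monotone hy))
        (by simpa using hl))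
    (fun {b} k x R hR h a g y l hy hl => by
      refine T.mem_of_cover (J.pullback_stable
        (Total.homMk g hy : Total.mk a y ⟶ Total.mk b x) hR) fun Y m hm => ?_
      exact h Y _ hm Y.base (𝟙 _) Y.elt _ (by simp) (by simp [hl]))

theorem pullback_le_iff {d c : C} {f : d ⟶ c} {S : ClosedPairs P J c} {T : ClosedPairs P J d} :
    S.pullback f ≤ T ↔ S ≤ forallAlong f T := by
  rw [le_def, le_def]
  constructor
  · intro h b k x hx a g y l hy hl
    refine h l y ?_
    rw [mem_pullback, hl]
    exact hx.comp g hy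
  · intro h a l y hy
    exact h _ y hy a (𝟙 a) y l (by simp) (by simp)

/-- The image of a closed set of pairs under the left adjoint of the pullback. -/
def existsAlong {d c : C} (f : d ⟶ c) (S : ClosedPairs P J d) : ClosedPairs P J c :=
  closure {p | ∃ (e : C) (g : e ⟶ d) (x : P.obj (op e)), S.Mem g x ∧ p = ⟨e, g ≫ f, x⟩}

theorem existsAlong_le_iff {d c : C} {f : d ⟶ c} {S : ClosedPairs P J d}
    {T : ClosedPairs P J c} : existsAlong f S ≤ T ↔ S ≤ T.pullback f := by
  rw [existsAlong, closure_le, le_def]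
  constructor
  · exact fun h e g x hx => h ⟨e, g, x, hx, rfl⟩
  · rintro h _ ⟨e, g, x, hx, rfl⟩
    exact h g x hx

/-- The closed set of pairs on `b` generated by `(𝟙 b, y)`. -/
def principal {b : C} (y : P.obj (op b)) : ClosedPairs P J b :=
  closure {⟨b, 𝟙 b, y⟩}

/-- A Yoneda-type statement: it turns a pair into an object of the total category of the doctrine of
closed sets, to which a sieve there can be applied. -/
theorem principal_le_iff {b : C} {y : P.obj (op b)} {S : ClosedPairs P J b} :
    principal y ≤ S ↔ S.Mem (𝟙 b) y := by
  rw [principal, closure_le, Set.singleton_subset_iff]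
  rfl

end ClosedPairs

/-! ### Closed sets of pairs form a geometric doctrine -/

open ClosedPairs

theorem closedPairs_exists_directImage {d c : C} (f : d ⟶ c)
    (u : (closedPairsDoctrine P J).obj (op d)) :
    ∃ a, IsDirectImage (closedPairsDoctrine P J) f u a :=
  ⟨existsAlong f u, fun _ => existsAlong_le_iff⟩

variable (P J) in
/-- The doctrine of closed sets of pairs is geometric. -/
theorem closedPairsDoctrine_isGeometric : IsGeometric (closedPairsDoctrine P J) where
  antisymm c a b h₁ h₂ := le_antisymm (α := ClosedPairs P J c) h₁ h₂
  exists_isLUB c s := by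
    change ∃ a : ClosedPairs P J c, IsLUB (α := ClosedPairs P J c) s a
    refine ⟨closure (⋃ S : s, ClosedPairs.pairs (P := P) (J := J) S.1),
      (isLUB_iff_le_iff (α := ClosedPairs P J c)).2 fun b => ?_⟩
    rw [closure_le, Set.iUnion_subset_iff]
    exact ⟨fun h S hS => h ⟨S, hS⟩, fun h S => h S.2⟩
  inf_sSup c a b m s hs hm := by
    change ClosedPairs P J c at a b m
    change Set (ClosedPairs P J c) at s
    change IsLUB (α := ClosedPairs P J c) _ _ at hs
    change IsGLB (α := ClosedPairs P J c) _ _ at hm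
    change IsLUB (α := ClosedPairs P J c) _ _
    refine ⟨?_, fun T hT => ?_⟩
    · rintro n ⟨y, hy, hn⟩
      exact le_def.2 fun f x hx => (mem_of_isGLB hm).2
        (((mem_of_isGLB hn).1 hx).imp_right (le_def.1 (hs.1 hy) f x))
    · refine (le_imp_iff hm).1 (hs.2 fun y hy => ?_)
      have hn : IsGLB {a, y} (inter a y) := isGLB_of_mem fun _ _ => Iff.rfl
      exact (le_imp_iff hn).2 (hT ⟨y, hy, hn⟩)
  map_top {d c} f a ha x p _ :=
    ha (ClosedPairs.univ c) (show ⟨p.1, p.2.1 ≫ f, p.2.2⟩ ∈ (ClosedPairs.univ c).pairs from trivial)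
  map_inf {d c} f a b m hm :=
    isGLB_of_mem (S := ClosedPairs.pullback f a) (T := ClosedPairs.pullback f b)
      (M := ClosedPairs.pullback f m) fun g x =>
        mem_of_isGLB (S := a) (T := b) (M := m) (f := g ≫ f) hm
  map_sSup {d c} f s a ha := by
    change ClosedPairs P J c at a
    change Set (ClosedPairs P J c) at s
    change IsLUB (α := ClosedPairs P J c) _ _ at ha
    change IsLUB (α := ClosedPairs P J d) (ClosedPairs.pullback f '' s) (a.pullback f)
    rw [isLUB_iff_le_iff]
    intro b
    rw [pullback_le_iff, isLUB_le_iff ha, mem_upperBounds, mem_upperBounds, Set.forall_mem_image]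
    exact forall₂_congr fun S _ => pullback_le_iff.symm
  exists_directImage := closedPairs_exists_directImage
  frobenius {d c} f u m a b n ha hm hn t := by
    change ClosedPairs P J c at a b n t
    change ClosedPairs P J d at u m
    change IsGLB (α := ClosedPairs P J d) {u, b.pullback f} m at hm
    change IsGLB (α := ClosedPairs P J c) {a, b} n at hn
    rw [Set.pair_comm] at hn hm
    -- By adjunction, Frobenius reduces to pullback commuting with implication, which is
    -- associativity of composition.
    refine (le_imp_iff (T := t) hn).symm.trans ((ha _).trans ?_)
    refine Iff.trans (b := u ≤ imp (b.pullback f) (t.pullback f)) ?_ (le_imp_iff hm)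
    change u ≤ (imp b t).pullback f ↔ _
    rw [le_def, le_def]
    refine forall_congr' fun e => forall₃_congr fun k x _ => ?_
    refine forall₄_congr fun e' g y _ => ?_
    rw [mem_pullback, mem_pullback, Category.assoc]
  beckChevalley {e d} h V S hS := by
    rw [isJoinCover_iff closedPairs_exists_directImage] at hS ⊢
    intro T
    change ClosedPairs P J d at V
    change ClosedPairs P J e at T
    constructor
    · rintro H Y f -
      exact (Total.Hom.le f).trans
        (((closedPairsDoctrine P J).map (Total.Hom.base f).op).hom.monotone H)
    · intro H
      -- The join cover lives over d, so the bound T over e is moved there as `forallAlong h T`.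
      refine pullback_le_iff.2 ((hS (forallAlong h T)).2 ?_)
      rintro ⟨c, U⟩ f hf
      change ClosedPairs P J c at U
      change U ≤ (forallAlong h T).pullback (Total.Hom.base f)
      rw [le_def]
      intro a g₀ x hx b g y k hy hk
      -- U itself has no arrow to e. The principal set on y has one, namely k, and the square `hk`
      -- factors `k ≫ h` through the arrow f of S, so k lies in the pulled-back sieve.
      have hU : (principal y : ClosedPairs P J b) ≤ U.pullback (g ≫ g₀) := by
        rw [principal_le_iff, mem_pullback, Category.id_comp]
        exact hx.comp g hy
      have hV : U ≤ V.pullback (Total.Hom.base f) := Total.Hom.le f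
      have hW : (principal y : ClosedPairs P J b) ≤ (V.pullback h).pullback k := by
        rw [principal_le_iff, mem_pullback, mem_pullback, Category.id_comp, hk]
        have := le_def.1 hV (g ≫ g₀) y (hx.comp g hy)
        simpa [mem_pullback] using this
      have hmem := H (Total.mk b (principal y : ClosedPairs P J b)) (Total.homMk k hW) (by
        let j : (Total.mk b (principal y : ClosedPairs P J b) :
            Total (closedPairsDoctrine P J)) ⟶ Total.mk c U := Total.homMk (g ≫ g₀) hU
        have := S.downward_closed hf j
        refine cast (congrArg (fun q => S.arrows q) (Total.Hom.ext ?_)) this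
        exact (Category.assoc _ _ _).trans hk.symm)
      have := principal_le_iff.1 (show (principal y : ClosedPairs P J b) ≤ T.pullback k from hmem)
      simpa [mem_pullback] using this

/-! ### The completion as closed sets of pairs -/

namespace CompletionFibre

/-- Compatibility with pullback reduces membership of any arrow to membership of an identity. -/
theorem sieve_iff_id {c : C} (x : CompletionFibre P J c) {X Y : Total P} (g : Y ⟶ X)
    (f : X.base ⟶ c) : x.sieve X f g ↔ x.sieve Y (Total.Hom.base g ≫ f) (𝟙 Y) := by
  rw [← pullback_sieve, Sieve.pullback_apply, Category.id_comp]

/-- The set of pairs `(f, y)` at which an element of the completion is the maximal sieve. -/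
noncomputable def toClosedPairs {c : C} (x : CompletionFibre P J c) : ClosedPairs P J c :=
  ofPred (fun {d} f y => x.sieve (Total.mk d y) f (𝟙 (Total.mk d y)))
    (fun {d e} f y g z h hz => by
      have := (x.sieve (Total.mk d y) f).downward_closed h
        (Total.homMk g hz : Total.mk e z ⟶ Total.mk d y)
      rw [Category.comp_id, sieve_iff_id] at this
      exact this)
    (fun {d} f y R hR h => by
      refine x.isClosed_sieve (Total.mk d y) f (𝟙 _) ?_
      rw [GrothendieckTopology.covers_iff, Sieve.pullback_id]
      exact J.superset_covering (fun Y g hg => (x.sieve_iff_id g f).2 (h Y g hg)) hR)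

theorem toClosedPairs_le_iff {c : C} {x y : CompletionFibre P J c} :
    x.toClosedPairs ≤ y.toClosedPairs ↔ x ≤ y := by
  rw [ClosedPairs.le_def, CompletionFibre.le_iff]
  constructor
  · intro h X f Y g hg
    rw [sieve_iff_id] at hg ⊢
    exact h _ _ hg
  · intro h d f z hz
    exact h (Total.mk d z) f _ hz

theorem toClosedPairs_injective {c : C} :
    Function.Injective (toClosedPairs : CompletionFibre P J c → ClosedPairs P J c) := by
  intro x y h
  have h₁ := (CompletionFibre.le_iff x y).1 (toClosedPairs_le_iff.1 h.le)
  have h₂ := (CompletionFibre.le_iff y x).1 (toClosedPairs_le_iff.1 h.ge)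
  exact directImage_ext (Sheaf.Ω J) c x y fun X f => Subtype.ext
    (show x.sieve X f = y.sieve X f from le_antisymm (h₁ X f) (h₂ X f))

theorem toClosedPairs_surjective {c : C} :
    Function.Surjective (toClosedPairs : CompletionFibre P J c → ClosedPairs P J c) := by
  intro S
  -- The only possible family: g belongs at (X, f) exactly when its composite with f gives a pair of
  -- S. The two closure conditions on S make it a family of closed sieves.
  let s : ∀ (X : Total P) (_ : X.base ⟶ c), Sieve X := fun X f =>
    { arrows := fun Y g => S.Mem (Total.Hom.base g ≫ f) Y.elt
      downward_closed := fun {Y Z} g hg k => by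
        simpa using Mem.comp hg (Total.Hom.base k) (Total.Hom.le k) }
  have hs : ∀ X f, J.IsClosed (s X f) := fun X f Y g hg =>
    S.mem_of_cover (x := Y.elt) hg fun Z k hk => by
      have : S.Mem (Total.Hom.base (k ≫ g) ≫ f) Z.elt := hk
      simpa using this
  obtain ⟨z, hz⟩ := directImage_exists (Sheaf.Ω J) c (fun X f => ⟨s X f, hs X f⟩)
    (fun X Y g f => Subtype.ext (Sieve.ext fun Z k => by
      change S.Mem (Total.Hom.base (k ≫ g) ≫ f) Z.elt ↔
        S.Mem (Total.Hom.base k ≫ Total.Hom.base g ≫ f) Z.elt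
      simp))
  refine ⟨z, ClosedPairs.ext ?_⟩
  ext ⟨d, f, x⟩
  have h : CompletionFibre.sieve (P := P) (J := J) z (Total.mk d x) f = s (Total.mk d x) f :=
    congrArg Subtype.val (hz (Total.mk d x) f)
  change CompletionFibre.sieve (P := P) (J := J) z (Total.mk d x) f (𝟙 _) ↔ _
  rw [h]
  change S.Mem (𝟙 d ≫ f) x ↔ S.Mem f x
  rw [Category.id_comp]

theorem sieve_map {d c : C} (f : d ⟶ c) (x : CompletionFibre P J c) (X : Total P)
    (g : X.base ⟶ d) :
    CompletionFibre.sieve (P := P) (J := J) (((directImage P J).obj (Sheaf.Ω J)).map f.op x) X g =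
      x.sieve X (g ≫ f) := by
  unfold CompletionFibre.sieve
  rw [op_comp]
  exact congrArg (fun z => (directImageEval (Sheaf.Ω J) X z).1)
    (ConcreteCategory.congr_hom
      (((directImage P J).obj (Sheaf.Ω J)).map_comp f.op g.op) x).symm

end CompletionFibre

variable (P J) in
/-- The elements of the geometric completion are the closed sets of pairs. -/
noncomputable def completionOrderIso (c : C) :
    (geometricCompletion P J).obj (op c) ≃o (closedPairsDoctrine P J).obj (op c) where
  toEquiv := Equiv.ofBijective (CompletionFibre.toClosedPairs (P := P) (J := J) (c := c))
    ⟨CompletionFibre.toClosedPairs_injective, CompletionFibre.toClosedPairs_surjective⟩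
  map_rel_iff' := CompletionFibre.toClosedPairs_le_iff

theorem completionOrderIso_map {d c : C} (f : d ⟶ c) (x : (geometricCompletion P J).obj (op c)) :
    completionOrderIso P J d ((geometricCompletion P J).map f.op x) =
      (closedPairsDoctrine P J).map f.op (completionOrderIso P J c x) := by
  refine ClosedPairs.ext ?_
  ext ⟨e, g, y⟩
  exact iff_of_eq (congrArg (fun R => R.arrows (𝟙 (Total.mk e y)))
    (CompletionFibre.sieve_map f x (Total.mk e y) g))

variable (P J) in
theorem geometricCompletion_isGeometric : IsGeometric (geometricCompletion P J) :=
  (closedPairsDoctrine_isGeometric P J).of_orderIso (fun c => (completionOrderIso P J c).symm)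
    fun f x => by
      rw [OrderIso.symm_apply_eq, completionOrderIso_map, OrderIso.apply_symm_apply]

variable (P J) in
/-- The geometric completion is the doctrine of closed sets of pairs. -/
noncomputable def completionIso : geometricCompletion P J ≅ closedPairsDoctrine P J :=
  isoOfOrderIso (completionOrderIso P J) completionOrderIso_map

/-! ### Invariance under the free top completion -/

namespace ClosedPairs

/-- Restriction of a closed set of pairs from `P^⊤` to `P`. -/
def restrict {c : C} (S : ClosedPairs (freeTop P) (freeTopTopology J) c) : ClosedPairs P J c :=
  ofPred (fun {d} f x => S.Mem f ((x : P.obj (op d)) : WithTop (P.obj (op d))))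
    (fun _ _ g _ h hy => h.comp g (WithTop.coe_le_coe.2 hy))
    (fun {d} f x R hR h => by
      -- J^⊤ is tested after restriction to C ⋊ P, and the restriction of the pushforward contains
      -- R.
      refine S.mem_of_cover (R := R.functorPushforward (freeTopIncl P))
        ((mem_freeTopTopology_incl P J (Total.mk d x) _).2
          (J.superset_covering (R.le_functorPushforward_pullback _) hR)) ?_
      rintro Y _ ⟨Z, g, k, hg, rfl⟩
      have hZ : S.Mem (Total.Hom.base g ≫ f) ((freeTopIncl P).obj Z).elt := h Z g hg
      let k' : Y.base ⟶ Z.base := Total.Hom.base k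
      have := hZ.comp k' (Total.Hom.le k)
      rwa [← Category.assoc] at this)

/-- Extension of a closed set of pairs from `P` to `P^⊤`. -/
def extend {c : C} (T : ClosedPairs P J c) : ClosedPairs (freeTop P) (freeTopTopology J) c :=
  -- For x in P the identity is among these arrows, so this reduces to membership in T; at ⊤ the
  -- value is forced, as the arrows from C ⋊ P are covering.
  ofPred (fun {d} f x => ∀ (Y : Total P) (g : (freeTopIncl P).obj Y ⟶ Total.mk d x),
      T.Mem (Total.Hom.base g ≫ f) Y.elt)
    (fun {d e} f x g y h hy Y k => by
      have := h Y (k ≫ (Total.homMk g hy :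
        (Total.mk e y : Total (freeTop P)) ⟶ Total.mk d x))
      rw [Total.comp_base, Category.assoc] at this
      exact this)
    (fun {d} f x R hR h Y g => by
      refine T.mem_of_cover (x := Y.elt) (hR Y g) fun Z k hk => ?_
      have := h _ _ hk Z (𝟙 _)
      rw [Total.id_base, Category.id_comp, Total.comp_base, Category.assoc] at this
      exact this)

theorem restrict_extend {c : C} (T : ClosedPairs P J c) : T.extend.restrict = T := by
  refine ClosedPairs.ext ?_
  ext ⟨d, f, x⟩
  constructor
  · intro h
    have := h (Total.mk d x) (𝟙 _)
    exact T.mem_id_comp.1 this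
  · intro h Y g
    exact Mem.comp (S := T) h _ (WithTop.coe_le_coe.1 (Total.Hom.le g))

theorem extend_restrict {c : C} (S : ClosedPairs (freeTop P) (freeTopTopology J) c) :
    S.restrict.extend = S := by
  refine ClosedPairs.ext ?_
  ext ⟨d, f, x⟩
  constructor
  · intro h
    -- The arrows factoring through C ⋊ P. The pullback of R along an arrow from an object of C ⋊ P
    -- is maximal, hence R is J^⊤-covering.
    let R : Sieve (Total.mk d x : Total (freeTop P)) :=
      { arrows := fun Y g => ∃ (Z : Total P) (k : Y ⟶ (freeTopIncl P).obj Z)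
          (l : (freeTopIncl P).obj Z ⟶ Total.mk d x), k ≫ l = g
        downward_closed := by
          rintro Y Y' _ ⟨Z, k, l, rfl⟩ m
          exact ⟨Z, m ≫ k, l, Category.assoc _ _ _⟩ }
    refine S.mem_of_cover (R := R) (fun Y g => ?_) ?_
    · convert J.top_mem Y
      rw [← Sieve.id_mem_iff_eq_top]
      exact ⟨Y, 𝟙 _, g, by simp⟩
    · rintro Y _ ⟨Z, k, l, rfl⟩
      have := Mem.comp (S := S) (h Z l) (Total.Hom.base k) (Total.Hom.le k)
      rwa [← Category.assoc] at this
  · intro h Y g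
    exact Mem.comp (S := S) h _ (Total.Hom.le g)

end ClosedPairs

variable (P J) in
/-- The closed sets of pairs for `P^⊤` are those for `P`. -/
def restrictOrderIso (c : C) :
    (closedPairsDoctrine (freeTop P) (freeTopTopology J)).obj (op c) ≃o
      (closedPairsDoctrine P J).obj (op c) where
  toFun := ClosedPairs.restrict
  invFun := ClosedPairs.extend
  left_inv := extend_restrict
  right_inv := restrict_extend
  map_rel_iff' {S T} := by
    constructor
    · intro h
      have : ClosedPairs.extend (ClosedPairs.restrict S) ≤
          ClosedPairs.extend (ClosedPairs.restrict T) :=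
        le_def.2 fun f x hx Y g => le_def.1 h _ _ (hx Y g)
      exact (extend_restrict S).ge.trans (this.trans (extend_restrict T).le)
    · intro h
      exact le_def.2 fun f x hx => le_def.1 h _ _ hx

variable (P J) in
/-- The doctrine of closed sets of pairs is invariant under the free top completion. -/
def restrictIso : closedPairsDoctrine (freeTop P) (freeTopTopology J) ≅ closedPairsDoctrine P J :=
  isoOfOrderIso (restrictOrderIso P J) fun _ _ => rfl

end Doctrine

theorem proposition4p7 {C : Type u} [CategoryTheory.Category.{v} C]
    (P : Cᵒᵖ ⥤ Preord.{w}) (J : CategoryTheory.GrothendieckTopology (Doctrine.Total P)) :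
    (Doctrine.IsGeometric (Doctrine.geometricCompletion P J) ∧
      Doctrine.IsGeometric (Doctrine.geometricCompletion (Doctrine.freeTop P)
        (Doctrine.freeTopTopology J)) ∧
      Doctrine.IsGeometric (Doctrine.closedPairsDoctrine (Doctrine.freeTop P)
        (Doctrine.freeTopTopology J)) ∧
      Doctrine.IsGeometric (Doctrine.closedPairsDoctrine P J)) ∧
    Nonempty (Doctrine.geometricCompletion P J ≅
      Doctrine.geometricCompletion (Doctrine.freeTop P) (Doctrine.freeTopTopology J)) ∧
    Nonempty (Doctrine.geometricCompletion (Doctrine.freeTop P) (Doctrine.freeTopTopology J) ≅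
      Doctrine.closedPairsDoctrine (Doctrine.freeTop P) (Doctrine.freeTopTopology J)) ∧
    Nonempty (Doctrine.closedPairsDoctrine (Doctrine.freeTop P) (Doctrine.freeTopTopology J) ≅
      Doctrine.closedPairsDoctrine P J) ∧
    Nonempty (Doctrine.geometricCompletion P J ≅ Doctrine.closedPairsDoctrine P J) := by
  open Doctrine in
  exact ⟨⟨geometricCompletion_isGeometric P J, geometricCompletion_isGeometric _ _,
    closedPairsDoctrine_isGeometric _ _, closedPairsDoctrine_isGeometric P J⟩,
    -- The two completions are compared through their closed sets of pairs, with no direct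
    -- comparison of the sheaf toposes.
    ⟨completionIso P J ≪≫ (restrictIso P J).symm ≪≫ (completionIso _ _).symm⟩,
    ⟨completionIso _ _⟩, ⟨restrictIso P J⟩, ⟨completionIso P J⟩⟩
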